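/- A multi-player multi-armed bandit (MPMAB) instance has $M\ge 1$ players and $K$ arms; each player $p\in[M]$ and arm $i\in[K]$ has a reward distribution $\mathcal D_i^p$ supported in $[0,1]$ with mean $\mu_i^p$. Put $\mu_*^p=\max_{i}\mu_i^p$, $\Delta_i^p=\mu_*^p-\mu_i^p$ and $\Delta_i^{\min}=\min_{p}\Delta_i^p$. For $\epsilon\in[0,1]$, it is an $\epsilon$-MPMAB instance if $|\mu_i^p-\mu_i^q|\le\epsilon$ for all $p,q\in[M]$ and $i\in[K]$, and its set of subpar arms is $\mathcal I_\epsilon=\{i:\exists p\in[M],\ \mu_*^p-\mu_i^p>5\epsilon\}$. In each round $t=1,\dots,T$, where $T>\max(M,K)$, every player $p$ pulls an arm $i_t^p$ and receives an independently drawn reward $r_t^p\sim\mathcal D_{i_t^p}^p$; after the round all pulls and rewards are revealed to all players. Let $n_i^p(t)$ be the number of pulls of arm $i$ by player $p$ in the first $t$ rounds; the expected collective regret is $\mathbb E[\mathcal R(T)]=\sum_{p}\sum_{i}\Delta_i^p\,\mathbb E[n_i^p(T)]$. The algorithm $\mathrm{RobustAgg}(\epsilon)$ with horizon $T$ is as follows.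 In round $t$, for every player $p$ and arm $i$, let $\bar n=\max(1,n_i^p(t-1))$, $\bar m=\max(1,\sum_{q\ne p}n_i^q(t-1))$, $$\zeta=\frac1{\bar n}\sum_{s<t,\ i_s^p=i}r_s^p,\qquad \eta=\frac1{\bar m}\sum_{q\ne p}\ \sum_{s<t,\ i_s^q=i}r_s^q,\qquad F(\lambda)=8\sqrt{13\ln T\Big[\frac{\lambda^2}{\bar n}+\frac{(1-\lambda)^2}{\bar m}\Big]}+(1-\lambda)\epsilon,$$ let $\lambda^*$ minimize $F$ over $[0,1]$, and put $\mathrm{UCB}_i^p(t)=\lambda^*\zeta+(1-\lambda^*)\eta+F(\lambda^*)$. Player $p$ pulls an arm maximizing $\mathrm{UCB}_i^p(t)$ over $i\in[K]$, ties being broken in any way. **Statement.** There is a universal constant $C>0$ such that, for every $\epsilon\in[0,1]$ and every $\epsilon$-MPMAB instance with $|\mathcal I_\epsilon|=K-1$, the following holds. The complement $[K]\setminus\mathcal I_\epsilon$ is a singleton $\{i_*\}$, the arm $i_*$ is optimal for all players (that is, $\mu_{i_*}^p=\mu_*^p$ for all $p\in[M]$), $\Delta_i^{\min}>0$ for all $i\neq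 i_*$, and for every $T>\max(M,K)$, when $\mathrm{RobustAgg}(\epsilon)$ runs on the instance for $T$ rounds, $$\mathbb E[\mathcal R(T)]\ \le\ C\Big(\sum_{i\ne i_*}\frac{\ln T}{\Delta_i^{\min}}+M\sum_{i\ne i_*}\Delta_i^{\min}\Big).$$ -/

import Mathlib

open MeasureTheory ProbabilityTheory

namespace MPMAB

/-- A multi-player multi-armed bandit instance with `M` players and `K` arms: for every player `p`
and arm `i` a reward distribution supported in `[0,1]`. -/
structure Problem (M K : ℕ) where
  /-- reward distribution of arm `i` for player `p` -/
  dist : Fin M → Fin K → Measure ℝ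
  isProb : ∀ p i, IsProbabilityMeasure (dist p i)
  supp : ∀ p i, dist p i (Set.Icc (0 : ℝ) 1)ᶜ = 0

attribute [instance] Problem.isProb

noncomputable section

namespace Problem

variable {M K : ℕ} (I : Problem M K)

/-- Mean reward of arm `i` for player `p`. -/
def mean (p : Fin M) (i : Fin K) : ℝ := ∫ x, x ∂(I.dist p i)

/-- Optimal mean reward of player `p`. -/
def optMean (p : Fin M) : ℝ := ⨆ i : Fin K, I.mean p i

/-- Suboptimality gap of arm `i` for player `p`. -/
def gap (p : Fin M) (i : Fin K) : ℝ := I.optMean p - I.mean p i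

/-- Smallest gap of arm `i` over all players. -/
def gapMin (i : Fin K) : ℝ := ⨅ p : Fin M, I.gap p i

/-- The instance is an `ε`-MPMAB instance. -/
def IsEps (ε : ℝ) : Prop :=
  0 ≤ ε ∧ ε ≤ 1 ∧ ∀ (p q : Fin M) (i : Fin K), |I.mean p i - I.mean q i| ≤ ε

open Classical in
/-- The set of subpar arms. -/
def subpar (ε : ℝ) : Finset (Fin K) :=
  Finset.univ.filter fun i => ∃ p : Fin M, 5 * ε < I.optMean p - I.mean p i

/-- Given the arms pulled by the players in a round, the rewards of the players are drawn
independently, that of player `p` from the distribution of the arm that `p` pulled. -/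
def rewardKernel : Kernel (Fin M → Fin K) (Fin M → ℝ) :=
  Kernel.ofFunOfCountable fun a => Measure.pi fun p => I.dist p (a p)

instance : IsMarkovKernel I.rewardKernel :=
  ⟨fun a => inferInstanceAs (IsProbabilityMeasure (Measure.pi fun p => I.dist p (a p)))⟩

end Problem

/-- What is observed in one round: the arms pulled by all players, and their rewards. -/
abbrev Round (M K : ℕ) : Type := (Fin M → Fin K) × (Fin M → ℝ)

/-- What is observed in the first `t` rounds. -/
abbrev History (M K t : ℕ) : Type := Fin t → Round M K

/-- A multi-player bandit algorithm: for every `t`, the conditional distribution of the arms pulled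
by all players in round `t + 1`, given the observations of the first `t` rounds. -/
structure Algorithm (M K : ℕ) where
  policy : (t : ℕ) → Kernel (History M K t) (Fin M → Fin K)
  isMarkov : ∀ t, IsMarkovKernel (policy t)

attribute [instance] Algorithm.isMarkov

section Interaction

variable {M K : ℕ} (I : Problem M K) (A : Algorithm M K)

/-- Conditional law of the observations of round `t + 1` given those of the first `t` rounds. -/
def stepKernel (t : ℕ) : Kernel (History M K t) (Round M K) :=
  A.policy t ⊗ₖ Kernel.prodMkLeft (History M K t) I.rewardKernel

instance (t : ℕ) : IsMarkovKernel (stepKernel I A t) := by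
  unfold stepKernel; infer_instance

/-- Joint law of the observations of the first `t` rounds when `A` runs on `I`. -/
def historyLaw : (t : ℕ) → Measure (History M K t)
  | 0 => Measure.dirac Fin.elim0
  | t + 1 => (historyLaw t ⊗ₘ stepKernel I A t).map
      fun x => (Fin.snoc x.1 x.2 : History M K (t + 1))

lemma measurable_snoc {t : ℕ} : Measurable fun x : History M K t × Round M K =>
    (Fin.snoc x.1 x.2 : History M K (t + 1)) := by
  refine measurable_pi_lambda _ fun s => ?_
  refine Fin.lastCases ?_ (fun s => ?_) s
  · simpa using measurable_snd
  · simp only [Fin.snoc_castSucc]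
    exact (measurable_pi_apply s).comp measurable_fst

instance (t : ℕ) : IsProbabilityMeasure (historyLaw I A t) := by
  induction t with
  | zero => unfold historyLaw; infer_instance
  | succ t ih =>
    unfold historyLaw
    exact Measure.isProbabilityMeasure_map measurable_snoc.aemeasurable

/-- Number of pulls of arm `i` by player `p` in the history `h`. -/
def pulls {t : ℕ} (h : History M K t) (p : Fin M) (i : Fin K) : ℕ :=
  (Finset.univ.filter fun s : Fin t => (h s).1 p = i).card

/-- Expected collective regret of `A` on `I` after `T` rounds. -/
def regret (T : ℕ) : ℝ :=
  ∑ p : Fin M, ∑ i : Fin K, I.gap p i * ∫ h, (pulls h p i : ℝ) ∂(historyLaw I A T)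

end Interaction

section RobustAgg

variable {M K t : ℕ}

/-- Number of pulls of arm `i` by the players other than `p`. -/
def otherPulls (h : History M K t) (p : Fin M) (i : Fin K) : ℕ :=
  ∑ q ∈ Finset.univ.erase p, pulls h q i

/-- Sum of the rewards that player `p` received from arm `i`. -/
def rewardSum (h : History M K t) (p : Fin M) (i : Fin K) : ℝ :=
  ∑ s ∈ Finset.univ.filter (fun s : Fin t => (h s).1 p = i), (h s).2 p

/-- `max 1 n` as a real number. -/
def atLeastOne (n : ℕ) : ℝ := ((max 1 n : ℕ) : ℝ)

/-- Empirical mean of arm `i` from the samples of player `p`. -/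
def ownMean (h : History M K t) (p : Fin M) (i : Fin K) : ℝ :=
  rewardSum h p i / atLeastOne (pulls h p i)

/-- Empirical mean of arm `i` from the samples of the players other than `p`. -/
def otherMean (h : History M K t) (p : Fin M) (i : Fin K) : ℝ :=
  (∑ q ∈ Finset.univ.erase p, rewardSum h q i) / atLeastOne (otherPulls h p i)

/-- Width of the confidence interval with weight `l`, horizon `T` and dissimilarity `ε`, for
effective sample sizes `n` and `m`. -/
def width (T : ℕ) (n m l ε : ℝ) : ℝ :=
  8 * √(13 * Real.log T * (l ^ 2 / n + (1 - l) ^ 2 / m)) + (1 - l) * ε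

lemma exists_optWeight (T : ℕ) (n m ε : ℝ) :
    ∃ l ∈ Set.Icc (0 : ℝ) 1, IsMinOn (fun l => width T n m l ε) (Set.Icc 0 1) l := by
  apply isCompact_Icc.exists_isMinOn ⟨0, by simp⟩
  unfold width
  fun_prop

/-- The weight in `[0,1]` that minimizes the width. -/
def optWeight (T : ℕ) (n m ε : ℝ) : ℝ := (exists_optWeight T n m ε).choose

/-- Upper confidence bound that player `p` computes for arm `i` from the history `h`. -/
def ucb (ε : ℝ) (T : ℕ) (h : History M K t) (p : Fin M) (i : Fin K) : ℝ :=
  let n := atLeastOne (pulls h p i)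
  let m := atLeastOne (otherPulls h p i)
  let l := optWeight T n m ε
  l * ownMean h p i + (1 - l) * otherMean h p i + width T n m l ε

/-- `A` is `RobustAgg(ε)` with horizon `T`: in each of the rounds `1, …, T` every player pulls an arm
that maximizes that player's upper confidence bound. Ties may be broken in any way. -/
def IsRobustAgg (ε : ℝ) (T : ℕ) (A : Algorithm M K) : Prop :=
  ∀ t < T, ∀ h : History M K t, ∀ᵐ a ∂(A.policy t h),
    ∀ (p : Fin M) (i : Fin K), ucb ε T h p i ≤ ucb ε T h p (a p)

end RobustAgg

end

end MPMAB

/-! The confidence interval that player `p` holds for arm `i` is no wider than one built from the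
pooled samples of all players, up to a bias `ε`. On the event `Concentrated`, each index lies
between the true mean and that mean plus twice the width (`abs_ucb_sub_le`). Pulling arm `i` then
forces its gap below `16 √(13 log T / (n + m)) + 2ε`. A subpar arm has gap above `3ε` for every
player, so the bias uses up less than two thirds of the gap, and the collective number of pulls is
`O(log T / gapMin²)` whenever anybody pulls the arm (`groupPulls_mul_sq_le`).

Concentration needs no stopping times. For each fixed `θ`, `expDev` has expectation at most 1 at
every time (`lintegral_expDev_le_one`). The random sample size `k` is handled by summing over all
its possible values, with `θ` tuned to `k`. The sum `excess` is at least 1 on bad histories and has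
expectation at most `1/T`.

One round adds at most `M` pulls, so overshoot and bad rounds cost at most `M` each in expectation
(`integral_groupPulls_le`). Gaps of one arm differ by at most `2ε < gapMin` between players, so
weighting pulls by gaps loses only a factor 2. -/

namespace MPMAB

/-! ### Counts and reward sums when a round is appended. -/

section Snoc

variable {M K t : ℕ}

lemma pulls_snoc (h : History M K t) (x : Round M K) (p : Fin M) (i : Fin K) :
    pulls (Fin.snoc h x : History M K (t + 1)) p i =
      pulls h p i + if x.1 p = i then 1 else 0 := by
  simp only [pulls, Finset.card_filter, Fin.sum_univ_castSucc, Fin.snoc_castSucc, Fin.snoc_last]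

lemma rewardSum_snoc (h : History M K t) (x : Round M K) (p : Fin M) (i : Fin K) :
    rewardSum (Fin.snoc h x : History M K (t + 1)) p i =
      rewardSum h p i + if x.1 p = i then x.2 p else 0 := by
  simp [rewardSum, Finset.sum_filter, Fin.sum_univ_castSucc]

lemma pulls_le (h : History M K t) (p : Fin M) (i : Fin K) : pulls h p i ≤ t := by
  simpa [pulls] using Finset.card_filter_le (Finset.univ : Finset (Fin t)) fun s => (h s).1 p = i

lemma rewardSum_of_pulls_eq_zero {h : History M K t} {p : Fin M} {i : Fin K}
    (hp : pulls h p i = 0) : rewardSum h p i = 0 := by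
  rw [pulls, Finset.card_eq_zero] at hp
  simp [rewardSum, hp]

lemma measurableSet_arm (s : Fin t) (p : Fin M) (i : Fin K) :
    MeasurableSet {h : History M K t | (h s).1 p = i} := by
  have : Measurable fun h : History M K t => (h s).1 p :=
    (measurable_pi_apply p).comp (measurable_fst.comp (measurable_pi_apply s))
  exact this (measurableSet_singleton i)

lemma measurable_pulls (p : Fin M) (i : Fin K) :
    Measurable fun h : History M K t => pulls h p i := by
  simp only [pulls, Finset.card_filter]
  exact Finset.measurable_sum _ fun s _ =>
    Measurable.ite (measurableSet_arm s p i) measurable_const measurable_const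

lemma measurable_rewardSum (p : Fin M) (i : Fin K) :
    Measurable fun h : History M K t => rewardSum h p i := by
  simp only [rewardSum, Finset.sum_filter]
  exact Finset.measurable_sum _ fun s _ =>
    Measurable.ite (measurableSet_arm s p i)
      ((measurable_pi_apply p).comp (measurable_snd.comp (measurable_pi_apply s))) measurable_const

end Snoc

/-! ### One-step disintegration of the law of the history. -/

section Law

variable {M K : ℕ} (I : Problem M K) (A : Algorithm M K)

lemma lintegral_historyLaw_succ {t : ℕ} {f : History M K (t + 1) → ENNReal} (hf : Measurable f) :
    ∫⁻ h, f h ∂(historyLaw I A (t + 1)) =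
      ∫⁻ h, ∫⁻ a, ∫⁻ r, f (Fin.snoc h (a, r)) ∂(I.rewardKernel a) ∂(A.policy t h)
        ∂(historyLaw I A t) := by
  have hf' : Measurable fun x : History M K t × Round M K =>
      f (Fin.snoc x.1 x.2 : History M K (t + 1)) := hf.comp measurable_snoc
  rw [historyLaw, lintegral_map hf measurable_snoc, Measure.lintegral_compProd hf']
  refine lintegral_congr fun h => ?_
  rw [stepKernel, Kernel.lintegral_compProd]
  · simp [Kernel.prodMkLeft_apply]
  · exact hf'.comp (measurable_const.prodMk measurable_id)

lemma rewardKernel_apply (a : Fin M → Fin K) :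
    I.rewardKernel a = Measure.pi fun p => I.dist p (a p) := rfl

end Law

/-! ### Exponential supermartingale for centred rewards. -/

section Deviation

variable {M K t : ℕ} (I : Problem M K)

/-- Number of pulls of arm `i` by the players in `Q`. -/
def groupPulls (h : History M K t) (Q : Finset (Fin M)) (i : Fin K) : ℕ := ∑ q ∈ Q, pulls h q i

/-- Sum of the centred rewards that the players in `Q` received from arm `i`. -/
noncomputable def groupDev (h : History M K t) (Q : Finset (Fin M)) (i : Fin K) : ℝ :=
  ∑ q ∈ Q, (rewardSum h q i - I.mean q i * pulls h q i)

lemma groupPulls_le (h : History M K t) (Q : Finset (Fin M)) (i : Fin K) :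
    groupPulls h Q i ≤ M * t := by
  calc groupPulls h Q i ≤ ∑ q ∈ Q, t := Finset.sum_le_sum fun q _ => pulls_le h q i
    _ = Q.card * t := by simp
    _ ≤ M * t := Nat.mul_le_mul_right _ (by simpa using Finset.card_le_univ Q)

lemma groupDev_of_groupPulls_eq_zero {h : History M K t} {Q : Finset (Fin M)} {i : Fin K}
    (hN : groupPulls h Q i = 0) : groupDev I h Q i = 0 := by
  rw [groupPulls, Finset.sum_eq_zero_iff] at hN
  exact Finset.sum_eq_zero fun q hq => by simp [hN q hq, rewardSum_of_pulls_eq_zero (hN q hq)]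

lemma measurable_groupPulls (Q : Finset (Fin M)) (i : Fin K) :
    Measurable fun h : History M K t => groupPulls h Q i :=
  Finset.measurable_sum _ fun q _ => measurable_pulls q i

lemma measurable_groupDev (Q : Finset (Fin M)) (i : Fin K) :
    Measurable fun h : History M K t => groupDev I h Q i :=
  Finset.measurable_sum _ fun q _ => (measurable_rewardSum q i).sub
    (measurable_const.mul (measurable_from_nat.comp (measurable_pulls q i)))

/-- The exponential of the centred rewards, compensated for its growth. -/
noncomputable def expDev (h : History M K t) (Q : Finset (Fin M)) (i : Fin K) (θ : ℝ) : ENNReal :=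
  ENNReal.ofReal (Real.exp (θ * groupDev I h Q i - θ ^ 2 / 8 * groupPulls h Q i))

lemma measurable_expDev (Q : Finset (Fin M)) (i : Fin K) (θ : ℝ) :
    Measurable fun h : History M K t => expDev I h Q i θ :=
  (Real.measurable_exp.comp ((measurable_const.mul (measurable_groupDev I Q i)).sub
    (measurable_const.mul (measurable_from_nat.comp (measurable_groupPulls Q i))))).ennreal_ofReal

lemma ae_mem_Icc (p : Fin M) (i : Fin K) : ∀ᵐ x ∂(I.dist p i), x ∈ Set.Icc (0 : ℝ) 1 :=
  mem_ae_iff.2 (I.supp p i)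

lemma mean_mem_Icc (p : Fin M) (i : Fin K) : I.mean p i ∈ Set.Icc (0 : ℝ) 1 := by
  refine ⟨integral_nonneg_of_ae ((ae_mem_Icc I p i).mono fun x hx => hx.1), ?_⟩
  have : I.mean p i ≤ ∫ _, (1 : ℝ) ∂(I.dist p i) :=
    integral_mono_ae (Integrable.of_mem_Icc 0 1 aemeasurable_id (ae_mem_Icc I p i))
      (integrable_const _) ((ae_mem_Icc I p i).mono fun x hx => hx.2)
  simpa using this

lemma hasSubgaussianMGF_dist (p : Fin M) (i : Fin K) :
    HasSubgaussianMGF (fun x => x - I.mean p i) ((‖(1 : ℝ) - 0‖₊ / 2) ^ 2) (I.dist p i) :=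
  hasSubgaussianMGF_of_mem_Icc (X := fun x : ℝ => x) aemeasurable_id (ae_mem_Icc I p i)

/-- Hoeffding's lemma: a variable in `[0,1]` has variance proxy 1/4, hence the compensator `θ ^ 2 /
8`. -/
lemma lintegral_exp_dist_le_one (p : Fin M) (i : Fin K) (θ : ℝ) :
    ∫⁻ x, ENNReal.ofReal (Real.exp (θ * (x - I.mean p i) - θ ^ 2 / 8)) ∂(I.dist p i) ≤ 1 := by
  have h := hasSubgaussianMGF_dist I p i
  have hint : Integrable (fun x => Real.exp (θ * (x - I.mean p i) - θ ^ 2 / 8)) (I.dist p i) := by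
    simp only [Real.exp_sub _ (θ ^ 2 / 8)]
    exact (h.integrable_exp_mul θ).div_const _
  rw [← ofReal_integral_eq_lintegral_ofReal hint (ae_of_all _ fun x => (Real.exp_pos _).le)]
  rw [← ENNReal.ofReal_one]
  apply ENNReal.ofReal_le_ofReal
  simp only [Real.exp_sub _ (θ ^ 2 / 8)]
  rw [integral_div, div_le_one (Real.exp_pos _)]
  refine (h.mgf_le θ).trans (Real.exp_le_exp.2 (le_of_eq ?_))
  simp
  ring

lemma lintegral_pi_prod_le_one {μ : Fin M → Measure ℝ} [∀ p, IsProbabilityMeasure (μ p)]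
    {g : Fin M → ℝ → ENNReal} (hg : ∀ p, Measurable (g p)) (h1 : ∀ p, ∫⁻ x, g p x ∂(μ p) ≤ 1) :
    ∫⁻ r, ∏ p, g p (r p) ∂(Measure.pi μ) ≤ 1 := by
  have hind := iIndepFun_pi (μ := μ) (X := fun p x => g p x) fun p => (hg p).aemeasurable
  have := lintegral_prod_eq_prod_lintegral_of_indepFun Finset.univ
    (fun p (r : Fin M → ℝ) => g p (r p)) hind fun p => (hg p).comp (measurable_pi_apply p)
  rw [this]
  refine Finset.prod_le_one' fun p _ => ?_
  have hmp := (measurePreserving_eval μ p).lintegral_comp (hg p)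
  exact hmp.trans_le (h1 p)

lemma groupPulls_snoc (h : History M K t) (x : Round M K) (Q : Finset (Fin M)) (i : Fin K) :
    groupPulls (Fin.snoc h x : History M K (t + 1)) Q i =
      groupPulls h Q i + ∑ q ∈ Q, if x.1 q = i then 1 else 0 := by
  simp only [groupPulls, pulls_snoc, Finset.sum_add_distrib]

/-- The product runs over all players, with factor 1 for those that add no sample, so that it fits
`lintegral_pi_prod_le_one`. -/
lemma expDev_snoc (h : History M K t) (x : Round M K) (Q : Finset (Fin M)) (i : Fin K) (θ : ℝ) :
    expDev I (Fin.snoc h x : History M K (t + 1)) Q i θ = expDev I h Q i θ *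
      ∏ q, if q ∈ Q ∧ x.1 q = i then
        ENNReal.ofReal (Real.exp (θ * (x.2 q - I.mean q (x.1 q)) - θ ^ 2 / 8)) else 1 := by
  have h1 : (∏ q, if q ∈ Q ∧ x.1 q = i then
      ENNReal.ofReal (Real.exp (θ * (x.2 q - I.mean q (x.1 q)) - θ ^ 2 / 8)) else 1) =
      ENNReal.ofReal (Real.exp (∑ q ∈ Q,
        if x.1 q = i then θ * (x.2 q - I.mean q i) - θ ^ 2 / 8 else 0)) := by
    rw [Real.exp_sum, ENNReal.ofReal_prod_of_nonneg fun _ _ => (Real.exp_pos _).le,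
      ← Finset.prod_filter_mul_prod_filter_not Finset.univ (fun q => q ∈ Q)]
    simp only [Finset.filter_mem_eq_inter, Finset.univ_inter]
    rw [Finset.prod_eq_one (s := Finset.filter _ _)]
    · rw [mul_one]
      refine Finset.prod_congr rfl fun q hq => ?_
      by_cases hx : x.1 q = i <;> simp [hq, hx]
    · intro q hq
      simp [(Finset.mem_filter.1 hq).2]
  rw [h1, expDev, expDev, ← ENNReal.ofReal_mul (Real.exp_pos _).le, ← Real.exp_add]
  congr 2
  simp only [groupPulls, groupDev, pulls_snoc, rewardSum_snoc]
  push_cast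
  simp only [Finset.mul_sum, ← Finset.sum_sub_distrib, ← Finset.sum_add_distrib]
  refine Finset.sum_congr rfl fun q _ => ?_
  split_ifs <;> ring

/-- Supermartingale property: given the past and the arms of the round, the new factors are
independent with mean at most 1, whatever the policy. -/
lemma lintegral_expDev_le_one (A : Algorithm M K) (Q : Finset (Fin M)) (i : Fin K) (θ : ℝ) :
    ∀ t, ∫⁻ h, expDev I h Q i θ ∂(historyLaw I A t) ≤ 1
  | 0 => by
    have h0 : ∀ h : History M K 0, expDev I h Q i θ = 1 := fun h => by
      simp [expDev, groupDev, groupPulls, pulls, rewardSum]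
    simp [h0]
  | t + 1 => by
    rw [lintegral_historyLaw_succ I A (measurable_expDev I Q i θ)]
    refine le_trans ?_ (lintegral_expDev_le_one A Q i θ t)
    refine lintegral_mono fun h => ?_
    calc _ ≤ ∫⁻ _, expDev I h Q i θ ∂(A.policy t h) := lintegral_mono fun a => ?_
      _ = _ := by simp
    simp only [expDev_snoc]
    have hg : ∀ q, Measurable fun x : ℝ => if q ∈ Q ∧ a q = i then
        ENNReal.ofReal (Real.exp (θ * (x - I.mean q (a q)) - θ ^ 2 / 8)) else 1 := fun q => by
      by_cases hq : q ∈ Q ∧ a q = i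
      · simp only [hq, and_self, if_true]
        fun_prop
      · simp only [hq, if_false]
        fun_prop
    rw [lintegral_const_mul]
    · refine mul_le_of_le_one_right' ?_
      rw [rewardKernel_apply]
      refine lintegral_pi_prod_le_one hg fun q => ?_
      by_cases hq : q ∈ Q ∧ a q = i
      · simp only [hq, and_self, if_true]
        simpa [hq.2] using lintegral_exp_dist_le_one I q i θ
      · simp [hq]
    · exact Finset.measurable_prod _ fun q _ => (hg q).comp (measurable_pi_apply q)

end Deviation

/-! ### Concentration by a union bound over sample sizes. -/

section Concentration

variable {M K t : ℕ} (I : Problem M K)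

/-- All empirical means that `RobustAgg` uses are concentrated. -/
def Concentrated (T : ℕ) (h : History M K t) : Prop :=
  ∀ (p : Fin M) (i : Fin K) (Q : Finset (Fin M)), Q = {p} ∨ Q = Finset.univ.erase p →
    |groupDev I h Q i| ≤ 4 * √(groupPulls h Q i * Real.log T)

/-- Bound for the indicator of the event that the rewards of arm `i` for the players in `Q` are not
concentrated. -/
noncomputable def groupExcess (T : ℕ) (h : History M K t) (Q : Finset (Fin M)) (i : Fin K) :
    ENNReal :=
  ∑ k ∈ Finset.range (T ^ 2 + 1), ((T : ENNReal) ^ 32)⁻¹ *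
    (expDev I h Q i (16 * √(Real.log T / k)) + expDev I h Q i (-(16 * √(Real.log T / k))))

/-- Bound for the indicator of the event that the history is not `Concentrated`. -/
noncomputable def excess (T : ℕ) (h : History M K t) : ENNReal :=
  ∑ p : Fin M, ∑ i : Fin K,
    (groupExcess I T h {p} i + groupExcess I T h (Finset.univ.erase p) i)

lemma measurable_groupExcess (T : ℕ) (Q : Finset (Fin M)) (i : Fin K) :
    Measurable fun h : History M K t => groupExcess I T h Q i :=
  Finset.measurable_sum _ fun _ _ => measurable_const.mul
    ((measurable_expDev I Q i _).add (measurable_expDev I Q i _))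

lemma measurable_excess (T : ℕ) : Measurable fun h : History M K t => excess I T h :=
  Finset.measurable_sum _ fun _ _ => Finset.measurable_sum _ fun _ _ =>
    (measurable_groupExcess I T _ _).add (measurable_groupExcess I T _ _)

lemma lintegral_groupExcess_le (A : Algorithm M K) (T t : ℕ) (Q : Finset (Fin M)) (i : Fin K) :
    ∫⁻ h, groupExcess I T h Q i ∂(historyLaw I A t) ≤
      ((T ^ 2 + 1 : ℕ) : ENNReal) * (((T : ENNReal) ^ 32)⁻¹ * 2) := by
  simp only [groupExcess]
  have hmeas : ∀ θ : ℝ, Measurable fun h : History M K t =>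
      expDev I h Q i θ + expDev I h Q i (-θ) := fun θ =>
    (measurable_expDev I Q i _).add (measurable_expDev I Q i _)
  rw [lintegral_finsetSum _ fun (k : ℕ) _ => (hmeas (16 * √(Real.log T / k))).const_mul _]
  refine (Finset.sum_le_card_nsmul _ _ (((T : ENNReal) ^ 32)⁻¹ * 2) fun k _ => ?_).trans ?_
  · rw [lintegral_const_mul _ (hmeas _), lintegral_add_left (measurable_expDev I Q i _)]
    gcongr
    rw [← one_add_one_eq_two]
    exact add_le_add (lintegral_expDev_le_one I A Q i _ t) (lintegral_expDev_le_one I A Q i _ t)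
  · simp

lemma lintegral_excess_le (A : Algorithm M K) {T : ℕ} (hT : max M K < T) (hT2 : 2 ≤ T) (t : ℕ) :
    ∫⁻ h, excess I T h ∂(historyLaw I A t) ≤ (T : ENNReal)⁻¹ := by
  have hM : M ≤ T := (le_max_left M K).trans hT.le
  have hK : K ≤ T := (le_max_right M K).trans hT.le
  -- Union over players, arms, two groups, `T ^ 2 + 1` sample sizes and two signs; the exponent 32
  -- leaves ample room.
  have key : M * (K * (2 * ((T ^ 2 + 1) * 2))) * T ≤ T ^ 32 := by
    have h1 : T ^ 2 + 1 ≤ T ^ 3 := by nlinarith [Nat.pow_le_pow_left hT2 2]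
    calc M * (K * (2 * ((T ^ 2 + 1) * 2))) * T ≤ T * (T * (T * (T ^ 3 * T))) * T := by gcongr
      _ = T ^ 8 := by ring
      _ ≤ T ^ 32 := Nat.pow_le_pow_right (by omega) (by norm_num)
  have hT0 : (T : ENNReal) ≠ 0 := by simp; omega
  have hTt : (T : ENNReal) ≠ ⊤ := by simp
  simp only [excess]
  have hmeas : ∀ (p : Fin M) (i : Fin K), Measurable fun h : History M K t =>
      groupExcess I T h {p} i + groupExcess I T h (Finset.univ.erase p) i := fun p i =>
    (measurable_groupExcess I T _ _).add (measurable_groupExcess I T _ _)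
  rw [lintegral_finsetSum _ fun p _ => Finset.measurable_sum _ fun i _ => hmeas p i]
  calc _ ≤ ∑ _p : Fin M, ∑ _i : Fin K,
        2 * (((T ^ 2 + 1 : ℕ) : ENNReal) * (((T : ENNReal) ^ 32)⁻¹ * 2)) := by
        refine Finset.sum_le_sum fun p _ => ?_
        rw [lintegral_finsetSum _ fun i _ => hmeas p i]
        refine Finset.sum_le_sum fun i _ => ?_
        rw [lintegral_add_left (measurable_groupExcess I T _ _), two_mul]
        exact add_le_add (lintegral_groupExcess_le I A T t _ i)
          (lintegral_groupExcess_le I A T t _ i)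
    _ = ((M * (K * (2 * ((T ^ 2 + 1) * 2))) : ℕ) : ENNReal) * ((T : ENNReal) ^ 32)⁻¹ := by
        simp
        ring
    _ ≤ (T : ENNReal)⁻¹ := by
        rw [← div_eq_mul_inv]
        refine ENNReal.div_le_of_le_mul ?_
        rw [mul_comm (T : ENNReal)⁻¹, ← div_eq_mul_inv,
          ENNReal.le_div_iff_mul_le (Or.inl hT0) (Or.inl hTt)]
        exact_mod_cast key

lemma ofReal_exp_neg_log {T : ℕ} (hT : 0 < T) :
    ENNReal.ofReal (Real.exp (32 * Real.log T)) = (T : ENNReal) ^ 32 := by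
  have hT' : (0 : ℝ) < T := by exact_mod_cast hT
  rw [mul_comm, Real.exp_mul, Real.exp_log hT']
  norm_cast

/-- Chernoff's argument applied pointwise: the summand whose index is the actual sample size is
already at least 1. -/
lemma one_le_groupExcess {T : ℕ} (hT : 2 ≤ T) (hM : M ≤ T) (ht : t ≤ T) {h : History M K t}
    {Q : Finset (Fin M)} {i : Fin K}
    (hQ : 4 * √(groupPulls h Q i * Real.log T) < |groupDev I h Q i|) :
    1 ≤ groupExcess I T h Q i := by
  set k := groupPulls h Q i with hk
  set S := groupDev I h Q i with hS
  have hL : 0 < Real.log T := Real.log_pos (by exact_mod_cast hT)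
  have hk0 : 0 < k := by
    rcases Nat.eq_zero_or_pos k with h0 | h0
    · rw [hS, groupDev_of_groupPulls_eq_zero I h0] at hQ
      simp [h0] at hQ
    · exact h0
  have hk0' : (0 : ℝ) < k := by exact_mod_cast hk0
  have hkT : k ∈ Finset.range (T ^ 2 + 1) := by
    have := (groupPulls_le h Q i).trans (Nat.mul_le_mul hM ht)
    rw [Finset.mem_range, pow_two]
    omega
  -- This `θ` maximizes `4θ √(k log T) - θ² k / 8`, with value `64 log T - 32 log T = 32 log T`.
  set θ := 16 * √(Real.log T / k) with hθ
  have hprod : √(Real.log T / k) * √(k * Real.log T) = Real.log T := by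
    rw [← Real.sqrt_mul (by positivity)]
    rw [show Real.log T / k * (k * Real.log T) = Real.log T ^ 2 by field_simp]
    exact Real.sqrt_sq hL.le
  have hsq : θ ^ 2 * k = 256 * Real.log T := by
    rw [hθ, mul_pow, Real.sq_sqrt (by positivity)]
    field_simp
    norm_num
  have hexp : 32 * Real.log T ≤ θ * |S| - θ ^ 2 / 8 * k := by
    have : θ * (4 * √(k * Real.log T)) ≤ θ * |S| :=
      mul_le_mul_of_nonneg_left hQ.le (by positivity)
    have h2 : θ * (4 * √(k * Real.log T)) = 64 * Real.log T := by
      rw [hθ]; linear_combination 64 * hprod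
    linarith
  refine le_trans ?_ (Finset.single_le_sum (fun _ _ => zero_le) hkT)
  have hT0 : (T : ENNReal) ^ 32 ≠ 0 := by simp; omega
  have hTt : (T : ENNReal) ^ 32 ≠ ⊤ := by simp
  rw [← ENNReal.inv_mul_cancel hT0 hTt]
  gcongr
  rw [← ofReal_exp_neg_log (by omega)]
  rcases abs_choice S with hs | hs
  · refine le_trans ?_ le_self_add
    refine ENNReal.ofReal_le_ofReal (Real.exp_le_exp.2 ?_)
    rw [hs] at hexp
    exact hexp
  · refine le_trans ?_ le_add_self
    refine ENNReal.ofReal_le_ofReal (Real.exp_le_exp.2 ?_)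
    rw [hs] at hexp
    rw [neg_sq, neg_mul_comm]
    exact hexp

lemma one_le_excess {T : ℕ} (hT : 2 ≤ T) (hM : M ≤ T) (ht : t ≤ T) {h : History M K t}
    (hc : ¬ Concentrated I T h) : 1 ≤ excess I T h := by
  simp only [Concentrated, not_forall, not_le] at hc
  obtain ⟨p, i, Q, hQ, hlt⟩ := hc
  refine (one_le_groupExcess I hT hM ht hlt).trans ?_
  refine le_trans ?_ (Finset.single_le_sum (fun _ _ => zero_le) (Finset.mem_univ p))
  refine le_trans ?_ (Finset.single_le_sum (fun _ _ => zero_le) (Finset.mem_univ i))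
  rcases hQ with rfl | rfl
  · exact le_self_add
  · exact le_add_self

end Concentration

/-! ### Validity and width of the confidence bounds. -/

section Confidence

variable {M K t : ℕ} (I : Problem M K)

lemma one_le_atLeastOne (n : ℕ) : 1 ≤ atLeastOne n := by
  unfold atLeastOne
  exact_mod_cast le_max_left 1 n

lemma le_atLeastOne (n : ℕ) : (n : ℝ) ≤ atLeastOne n := by
  unfold atLeastOne
  exact_mod_cast le_max_right 1 n

lemma half_lt_log {T : ℕ} (hT : 2 ≤ T) : 1 / 2 < Real.log T := by
  have h1 : Real.log 2 ≤ Real.log T := Real.log_le_log (by norm_num) (by exact_mod_cast hT)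
  linarith [Real.log_two_gt_d9]

lemma abs_groupMean_sub_le {T : ℕ} (hT : 2 ≤ T) {h : History M K t} {Q : Finset (Fin M)}
    {p : Fin M} {i : Fin K} {b : ℝ} (hb0 : 0 ≤ b) (hb : ∀ q ∈ Q, |I.mean q i - I.mean p i| ≤ b)
    (hc : |groupDev I h Q i| ≤ 4 * √(groupPulls h Q i * Real.log T)) :
    |(∑ q ∈ Q, rewardSum h q i) / atLeastOne (groupPulls h Q i) - I.mean p i| ≤
      4 * √(Real.log T / atLeastOne (groupPulls h Q i)) + b := by
  have hL := half_lt_log hT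
  rcases Nat.eq_zero_or_pos (groupPulls h Q i) with h0 | h0
  · have hsum : ∑ q ∈ Q, rewardSum h q i = 0 := by
      rw [groupPulls, Finset.sum_eq_zero_iff] at h0
      exact Finset.sum_eq_zero fun q hq => rewardSum_of_pulls_eq_zero (h0 q hq)
    have hm := mean_mem_Icc I p i
    -- Without samples the empirical mean is 0 by convention; the bound holds because its right side
    -- already exceeds the range of the means.
    have h4 : 1 ≤ 4 * √(Real.log T) := by
      have : 1 / 4 ≤ √(Real.log T) := Real.le_sqrt_of_sq_le (by linarith)
      linarith
    simp only [hsum, h0, atLeastOne]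
    simp only [zero_div, zero_sub, abs_neg, abs_of_nonneg hm.1]
    simpa using by linarith [hm.2]
  · set n := groupPulls h Q i with hn
    have hn0 : (0 : ℝ) < n := by exact_mod_cast h0
    have ha : atLeastOne n = n := by
      unfold atLeastOne
      rw [max_eq_right h0]
    have hdecomp : (∑ q ∈ Q, rewardSum h q i) - I.mean p i * n =
        groupDev I h Q i + ∑ q ∈ Q, (I.mean q i - I.mean p i) * pulls h q i := by
      rw [hn, groupPulls, groupDev]
      push_cast
      rw [Finset.mul_sum, ← Finset.sum_sub_distrib, ← Finset.sum_add_distrib]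
      exact Finset.sum_congr rfl fun q _ => by ring
    have hbias : |∑ q ∈ Q, (I.mean q i - I.mean p i) * pulls h q i| ≤ b * n := by
      refine (Finset.abs_sum_le_sum_abs _ _).trans ?_
      rw [hn, groupPulls]
      push_cast
      rw [Finset.mul_sum]
      refine Finset.sum_le_sum fun q hq => ?_
      rw [abs_mul, Nat.abs_cast]
      exact mul_le_mul_of_nonneg_right (hb q hq) (Nat.cast_nonneg _)
    have hsqrt : √(n * Real.log T) = √(Real.log T / n) * n := by
      rw [show (n : ℝ) * Real.log T = Real.log T / n * (n : ℝ) ^ 2 by field_simp,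
        Real.sqrt_mul (by positivity), Real.sqrt_sq hn0.le]
    rw [ha, div_sub' hn0.ne', abs_div, abs_of_pos hn0, div_le_iff₀ hn0, mul_comm (n : ℝ), hdecomp]
    refine (abs_add_le _ _).trans ?_
    rw [hsqrt] at hc
    linarith

lemma abs_combination_sub_le_width {T : ℕ} {n m l ε ζ η μ : ℝ} (hn : 0 < n) (hm : 0 < m)
    (hl : l ∈ Set.Icc (0 : ℝ) 1) (hζ : |ζ - μ| ≤ 4 * √(Real.log T / n))
    (hη : |η - μ| ≤ 4 * √(Real.log T / m) + ε) :
    |l * ζ + (1 - l) * η - μ| ≤ width T n m l ε := by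
  obtain ⟨hl0, hl1⟩ := hl
  have hl1' : 0 ≤ 1 - l := by linarith
  have hL : 0 ≤ Real.log T := Real.log_natCast_nonneg T
  have h1 : l * √(Real.log T / n) ≤
      √(13 * Real.log T * (l ^ 2 / n + (1 - l) ^ 2 / m)) := by
    apply Real.le_sqrt_of_sq_le
    rw [mul_pow, Real.sq_sqrt (by positivity)]
    have h2 : 0 ≤ Real.log T * ((1 - l) ^ 2 / m) := by positivity
    have h3 : 0 ≤ Real.log T * (l ^ 2 / n) := by positivity
    have h4 : l ^ 2 * (Real.log T / n) = Real.log T * (l ^ 2 / n) := by ring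
    linarith
  have h1' : (1 - l) * √(Real.log T / m) ≤
      √(13 * Real.log T * (l ^ 2 / n + (1 - l) ^ 2 / m)) := by
    apply Real.le_sqrt_of_sq_le
    rw [mul_pow, Real.sq_sqrt (by positivity)]
    have h2 : 0 ≤ Real.log T * ((1 - l) ^ 2 / m) := by positivity
    have h3 : 0 ≤ Real.log T * (l ^ 2 / n) := by positivity
    have h4 : (1 - l) ^ 2 * (Real.log T / m) = Real.log T * ((1 - l) ^ 2 / m) := by ring
    linarith
  rw [show l * ζ + (1 - l) * η - μ = l * (ζ - μ) + (1 - l) * (η - μ) by ring]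
  refine (abs_add_le _ _).trans ?_
  rw [abs_mul, abs_mul, abs_of_nonneg hl0, abs_of_nonneg hl1', width]
  have h5 := mul_le_mul_of_nonneg_left hζ hl0
  have h6 := mul_le_mul_of_nonneg_left hη hl1'
  linarith

lemma optWeight_mem (T : ℕ) (n m ε : ℝ) : optWeight T n m ε ∈ Set.Icc (0 : ℝ) 1 :=
  (exists_optWeight T n m ε).choose_spec.1

/-- Compare with the weight `n / (n + m)`, which gives every sample equal weight and variance term
`1 / (n + m)`. -/
lemma width_optWeight_le (T : ℕ) {n m ε : ℝ} (hn : 0 < n) (hm : 0 < m) (hε : 0 ≤ ε) :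
    width T n m (optWeight T n m ε) ε ≤ 8 * √(13 * Real.log T / (n + m)) + ε := by
  have hmem : n / (n + m) ∈ Set.Icc (0 : ℝ) 1 :=
    ⟨by positivity, (div_le_one (by positivity)).2 (by linarith)⟩
  refine ((exists_optWeight T n m ε).choose_spec.2 hmem).trans ?_
  have h1 : (n / (n + m)) ^ 2 / n + (1 - n / (n + m)) ^ 2 / m = 1 / (n + m) := by
    field_simp
    ring
  simp only [width, h1, mul_one_div]
  have : (1 - n / (n + m)) * ε ≤ ε := mul_le_of_le_one_left hε (by linarith [hmem.1])
  linarith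

/-- The width of the confidence interval that player `p` uses for arm `i`. -/
noncomputable def optWidth (ε : ℝ) (T : ℕ) (h : History M K t) (p : Fin M) (i : Fin K) : ℝ :=
  width T (atLeastOne (pulls h p i)) (atLeastOne (otherPulls h p i))
    (optWeight T (atLeastOne (pulls h p i)) (atLeastOne (otherPulls h p i)) ε) ε

lemma abs_ucb_sub_le {ε : ℝ} (hI : I.IsEps ε) {T : ℕ} (hT : 2 ≤ T) {h : History M K t}
    (hc : Concentrated I T h) (p : Fin M) (i : Fin K) :
    |ucb ε T h p i - optWidth ε T h p i - I.mean p i| ≤ optWidth ε T h p i := by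
  -- Own samples are unbiased; those of the other players carry a bias of at most `ε`, which the
  -- term `(1 - l) * ε` of the width absorbs.
  have hown := abs_groupMean_sub_le I hT (p := p) (b := 0) le_rfl (by simp)
    (hc p i {p} (Or.inl rfl))
  have hoth := abs_groupMean_sub_le I hT (p := p) hI.1 (fun q _ => hI.2.2 q p i)
    (hc p i (Finset.univ.erase p) (Or.inr rfl))
  simp only [groupPulls, Finset.sum_singleton, add_zero] at hown
  have := abs_combination_sub_le_width
    (lt_of_lt_of_le one_pos (one_le_atLeastOne (pulls h p i)))
    (lt_of_lt_of_le one_pos (one_le_atLeastOne (otherPulls h p i)))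
    (optWeight_mem T (atLeastOne (pulls h p i)) (atLeastOne (otherPulls h p i)) ε) hown hoth
  rw [show ucb ε T h p i - optWidth ε T h p i - I.mean p i = optWeight T (atLeastOne (pulls h p i))
        (atLeastOne (otherPulls h p i)) ε * ownMean h p i +
      (1 - optWeight T (atLeastOne (pulls h p i)) (atLeastOne (otherPulls h p i)) ε) *
        otherMean h p i - I.mean p i by simp [ucb, optWidth]]
  exact this

lemma groupPulls_univ (h : History M K t) (p : Fin M) (i : Fin K) :
    groupPulls h Finset.univ i = pulls h p i + otherPulls h p i :=
  (Finset.add_sum_erase _ _ (Finset.mem_univ p)).symm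

/-- A suboptimal arm is only pulled while it has few samples. -/
lemma groupPulls_mul_sq_le {ε : ℝ} (hI : I.IsEps ε) {T : ℕ} (hT : 2 ≤ T) {h : History M K t}
    (hc : Concentrated I T h) {p : Fin M} {i j : Fin K} {δ : ℝ} (hδ : 3 * ε < δ)
    (hgap : δ ≤ I.mean p j - I.mean p i) (hucb : ucb ε T h p j ≤ ucb ε T h p i) :
    groupPulls h Finset.univ i * δ ^ 2 ≤ 29952 * Real.log T := by
  have hε := hI.1
  have hL : 0 ≤ Real.log T := Real.log_natCast_nonneg T
  have hj := (abs_le.1 (abs_ucb_sub_le I hI hT hc p j)).1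
  have hi := (abs_le.1 (abs_ucb_sub_le I hI hT hc p i)).2
  have hn := one_le_atLeastOne (pulls h p i)
  have hm := one_le_atLeastOne (otherPulls h p i)
  have hw : optWidth ε T h p i ≤ _ :=
    width_optWeight_le T (lt_of_lt_of_le one_pos hn) (lt_of_lt_of_le one_pos hm) hε
  set x := atLeastOne (pulls h p i) + atLeastOne (otherPulls h p i) with hx
  have hx0 : 0 < x := by linarith
  have hNx : (groupPulls h Finset.univ i : ℝ) ≤ x := by
    rw [groupPulls_univ h p i]
    push_cast
    exact add_le_add (le_atLeastOne _) (le_atLeastOne _)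
  -- From `δ ≤ 16 √(13 log T / x) + 2ε` and `2ε < 2δ/3`; squaring gives `48² · 13 = 29952`.
  have h1 : δ / 48 ≤ √(13 * Real.log T / x) := by linarith
  have h2 : (δ / 48) ^ 2 ≤ 13 * Real.log T / x := by
    rw [← Real.sq_sqrt (show 0 ≤ 13 * Real.log T / x by positivity)]
    exact pow_le_pow_left₀ (by linarith) h1 2
  rw [le_div_iff₀ hx0] at h2
  have h3 := mul_le_mul_of_nonneg_right hNx (sq_nonneg δ)
  linarith

end Confidence

/-! ### Expected number of pulls of a suboptimal arm. -/

section Pulls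

variable {M K : ℕ} (I : Problem M K)

/-- The total number of pulls of arm `i`, truncated from below at `B + M`. -/
noncomputable def truncPulls {t : ℕ} (B : ℝ) (h : History M K t) (i : Fin K) : ENNReal :=
  ENNReal.ofReal (max (groupPulls h Finset.univ i : ℝ) (B + M))

lemma measurable_truncPulls (t : ℕ) (B : ℝ) (i : Fin K) :
    Measurable fun h : History M K t => truncPulls B h i :=
  ((measurable_from_nat.comp (measurable_groupPulls Finset.univ i)).max
    measurable_const).ennreal_ofReal

lemma groupPulls_snoc_le {t : ℕ} (h : History M K t) (x : Round M K) (i : Fin K) :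
    groupPulls (Fin.snoc h x : History M K (t + 1)) Finset.univ i ≤
      groupPulls h Finset.univ i + M := by
  rw [groupPulls_snoc]
  gcongr
  rw [← Finset.card_filter]
  simpa using Finset.card_filter_le (Finset.univ : Finset (Fin M)) fun q => x.1 q = i

/-- Truncation makes good rounds free: with at most `B` pulls the new ones stay below `B + M`, and
above `B` nobody pulls the arm. A bad round adds at most `M`, paid for by `1 ≤ excess`. -/
lemma truncPulls_snoc_le {T t : ℕ} (hT : 2 ≤ T) (hM : M ≤ T) (ht : t ≤ T) {B : ℝ}
    (h : History M K t) (x : Round M K) (i : Fin K)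
    (hx : Concentrated I T h → B < groupPulls h Finset.univ i → ∀ p, x.1 p ≠ i) :
    truncPulls B (Fin.snoc h x : History M K (t + 1)) i ≤
      truncPulls B h i + M * excess I T h := by
  have hN : (groupPulls (Fin.snoc h x : History M K (t + 1)) Finset.univ i : ℝ) ≤
      groupPulls h Finset.univ i + M := by exact_mod_cast groupPulls_snoc_le h x i
  have hM0 : (0 : ℝ) ≤ M := Nat.cast_nonneg M
  by_cases hc : Concentrated I T h
  · refine le_trans (ENNReal.ofReal_le_ofReal ?_) le_self_add
    rcases le_or_gt (groupPulls h Finset.univ i : ℝ) B with hB | hB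
    · exact max_le ((hN.trans (by linarith)).trans (le_max_right _ _)) (le_max_right _ _)
    · rw [groupPulls_snoc]
      simp [hx hc hB]
  · calc truncPulls B (Fin.snoc h x : History M K (t + 1)) i
        ≤ ENNReal.ofReal (max (groupPulls h Finset.univ i : ℝ) (B + M) + M) := by
          refine ENNReal.ofReal_le_ofReal (max_le ?_ ?_)
          · exact hN.trans (by gcongr; exact le_max_left _ _)
          · exact (le_max_right _ _).trans (le_add_of_nonneg_right hM0)
      _ ≤ truncPulls B h i + M := by
          refine ENNReal.ofReal_add_le.trans ?_
          simp [truncPulls]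
      _ ≤ truncPulls B h i + M * excess I T h := by
          gcongr
          exact le_mul_of_one_le_right' (one_le_excess I hT hM ht hc)

lemma lintegral_truncPulls_le {ε : ℝ} (hI : I.IsEps ε) {T : ℕ} {A : Algorithm M K}
    (hT : max M K < T) (hT2 : 2 ≤ T) (hA : IsRobustAgg ε T A) {i j : Fin K} {δ : ℝ}
    (hδ : 3 * ε < δ) (hgap : ∀ p, δ ≤ I.mean p j - I.mean p i) :
    ∀ t ≤ T, ∫⁻ h, truncPulls (29952 * Real.log T / δ ^ 2) h i ∂(historyLaw I A t) ≤
      ENNReal.ofReal (29952 * Real.log T / δ ^ 2 + M) + t * (M * (T : ENNReal)⁻¹) := by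
  have hM : M ≤ T := (le_max_left M K).trans hT.le
  have hδ0 : 0 < δ := by linarith [hI.1]
  have hL : 0 ≤ Real.log T := Real.log_natCast_nonneg T
  set B := 29952 * Real.log T / δ ^ 2 with hB
  intro t
  induction t with
  | zero =>
    intro _
    have h0 : ∀ h : History M K 0, truncPulls B h i = ENNReal.ofReal (B + M) := fun h => by
      rw [truncPulls, max_eq_right]
      simp only [groupPulls, pulls, Finset.univ_eq_empty, Finset.filter_empty, Finset.card_empty,
        Finset.sum_const_zero, Nat.cast_zero]
      positivity
    simp [h0]
  | succ t ih =>
    intro ht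
    rw [lintegral_historyLaw_succ I A (measurable_truncPulls (t + 1) B i)]
    calc _ ≤ ∫⁻ h, (truncPulls B h i + M * excess I T h) ∂(historyLaw I A t) := by
          refine lintegral_mono fun h => ?_
          calc _ ≤ ∫⁻ _, (truncPulls B h i + M * excess I T h) ∂(A.policy t h) := by
                refine lintegral_mono_ae ?_
                filter_upwards [hA t (by omega) h] with a ha
                calc _ ≤ ∫⁻ _, (truncPulls B h i + M * excess I T h) ∂(I.rewardKernel a) := by
                      refine lintegral_mono fun r =>
                        truncPulls_snoc_le I hT2 hM (by omega) h (a, r) i fun hc hlt p hp => ?_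
                      have hle := groupPulls_mul_sq_le I hI hT2 hc hδ (hgap p) (hp ▸ ha p j)
                      rw [hB, div_lt_iff₀ (by positivity)] at hlt
                      exact absurd hle (not_le.2 hlt)
                  _ = _ := by simp
            _ = _ := by simp
      _ = ∫⁻ h, truncPulls B h i ∂(historyLaw I A t) +
            M * ∫⁻ h, excess I T h ∂(historyLaw I A t) := by
          rw [lintegral_add_left (measurable_truncPulls t B i),
            lintegral_const_mul _ (measurable_excess I T)]
      _ ≤ (ENNReal.ofReal (B + M) + t * (M * (T : ENNReal)⁻¹)) + M * (T : ENNReal)⁻¹ :=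
          add_le_add (ih (by omega))
            (mul_le_mul_right (lintegral_excess_le I A hT hT2 t) _)
      _ = _ := by
          push_cast
          ring

lemma integral_groupPulls_le {ε : ℝ} (hI : I.IsEps ε) {T : ℕ} {A : Algorithm M K}
    (hT : max M K < T) (hT2 : 2 ≤ T) (hA : IsRobustAgg ε T A) {i j : Fin K} {δ : ℝ}
    (hδ : 3 * ε < δ) (hgap : ∀ p, δ ≤ I.mean p j - I.mean p i) :
    ∫ h, (groupPulls h Finset.univ i : ℝ) ∂(historyLaw I A T) ≤
      29952 * Real.log T / δ ^ 2 + 2 * M := by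
  have hL : 0 ≤ Real.log T := Real.log_natCast_nonneg T
  rw [integral_eq_lintegral_of_nonneg_ae (ae_of_all _ fun h => Nat.cast_nonneg _)
    (measurable_from_nat.comp (measurable_groupPulls Finset.univ i)).aestronglyMeasurable]
  refine ENNReal.toReal_le_of_le_ofReal (by positivity) ?_
  calc _ ≤ ∫⁻ h, truncPulls (29952 * Real.log T / δ ^ 2) h i ∂(historyLaw I A T) :=
        lintegral_mono fun h => ENNReal.ofReal_le_ofReal (le_max_left _ _)
    _ ≤ _ := lintegral_truncPulls_le I hI hT hT2 hA hδ hgap T le_rfl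
    _ = ENNReal.ofReal (29952 * Real.log T / δ ^ 2 + M) + M := by
        -- The `T` rounds cost `M / T` each, hence `M` in total.
        rw [mul_left_comm, ENNReal.mul_inv_cancel (by simp; omega) (by simp), mul_one]
    _ = _ := by
        rw [← ENNReal.ofReal_natCast M, ← ENNReal.ofReal_add (by positivity) (by positivity)]
        congr 1
        ring

lemma integrable_pulls (A : Algorithm M K) (T : ℕ) (p : Fin M) (i : Fin K) :
    Integrable (fun h => (pulls h p i : ℝ)) (historyLaw I A T) :=
  Integrable.of_mem_Icc 0 T (measurable_from_nat.comp (measurable_pulls p i)).aemeasurable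
    (ae_of_all _ fun h => ⟨Nat.cast_nonneg _, by exact_mod_cast pulls_le h p i⟩)

end Pulls

/-! ### Comparison of gaps between players, and regret per arm. -/

section Gaps

variable {M K : ℕ} (I : Problem M K)

lemma mean_le_optMean (p : Fin M) (i : Fin K) : I.mean p i ≤ I.optMean p :=
  le_ciSup (Set.finite_range _).bddAbove i

lemma gapMin_le_gap (p : Fin M) (i : Fin K) : I.gapMin i ≤ I.gap p i :=
  ciInf_le (Set.finite_range _).bddBelow p

lemma optMean_le_add [Nonempty (Fin K)] {ε : ℝ} (hI : I.IsEps ε) (p q : Fin M) :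
    I.optMean p ≤ I.optMean q + ε :=
  ciSup_le fun i => by linarith [(abs_le.1 (hI.2.2 p q i)).2, mean_le_optMean I q i]

lemma gap_le_add [Nonempty (Fin K)] {ε : ℝ} (hI : I.IsEps ε) (p q : Fin M) (i : Fin K) :
    I.gap p i ≤ I.gap q i + 2 * ε := by
  have h1 := optMean_le_add I hI p q
  have h2 := (abs_le.1 (hI.2.2 p q i)).1
  unfold Problem.gap
  linarith

lemma gap_le_gapMin_add [Nonempty (Fin M)] [Nonempty (Fin K)] {ε : ℝ} (hI : I.IsEps ε)
    (p : Fin M) (i : Fin K) : I.gap p i ≤ I.gapMin i + 2 * ε := by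
  have : I.gap p i - 2 * ε ≤ I.gapMin i :=
    le_ciInf fun q => by linarith [gap_le_add I hI p q i]
  linarith

/-- Some player has gap above `5ε`, and passing to another player loses at most `2ε`. -/
lemma lt_gapMin_of_mem_subpar [Nonempty (Fin M)] [Nonempty (Fin K)] {ε : ℝ} (hI : I.IsEps ε)
    {i : Fin K} (hi : i ∈ I.subpar ε) : 3 * ε < I.gapMin i := by
  simp only [Problem.subpar, Finset.mem_filter, Finset.mem_univ, true_and] at hi
  obtain ⟨p, hp⟩ := hi
  have := gap_le_gapMin_add I hI p i
  unfold Problem.gap at this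
  linarith

/-- An arm that is best for some player has gap 0 there, so it cannot be subpar and must be the only
remaining arm. -/
lemma mean_eq_optMean_of_compl_subpar [Nonempty (Fin M)] {ε : ℝ} (hI : I.IsEps ε)
    {j : Fin K} (hj : (I.subpar ε)ᶜ = {j}) (p : Fin M) : I.mean p j = I.optMean p := by
  have : Nonempty (Fin K) := ⟨j⟩
  obtain ⟨i, hi⟩ := exists_eq_ciSup_of_finite (f := fun i => I.mean p i)
  have hi' : I.mean p i = I.optMean p := hi
  have hmem : i ∈ (I.subpar ε)ᶜ := by
    rw [Finset.mem_compl]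
    intro hs
    have h1 := lt_gapMin_of_mem_subpar I hI hs
    have h2 := gapMin_le_gap I p i
    unfold Problem.gap at h2
    linarith [hI.1]
  rw [hj, Finset.mem_singleton] at hmem
  rw [← hmem, hi']

lemma sum_gap_mul_integral_pulls_le [Nonempty (Fin M)] {ε : ℝ} (hI : I.IsEps ε) {T : ℕ}
    {A : Algorithm M K} (hT : max M K < T) (hT2 : 2 ≤ T) (hA : IsRobustAgg ε T A) {i j : Fin K}
    (hj : ∀ p, I.mean p j = I.optMean p) (hi : i ∈ I.subpar ε) :
    ∑ p, I.gap p i * ∫ h, (pulls h p i : ℝ) ∂(historyLaw I A T) ≤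
      60000 * (Real.log T / I.gapMin i + M * I.gapMin i) := by
  have : Nonempty (Fin K) := ⟨i⟩
  have hδ := lt_gapMin_of_mem_subpar I hI hi
  have hδ0 : 0 < I.gapMin i := by linarith [hI.1]
  have hN := integral_groupPulls_le I hI hT hT2 hA (i := i) (j := j) hδ
    fun p => (gapMin_le_gap I p i).trans_eq (by rw [Problem.gap, hj])
  have hL : 0 ≤ Real.log T := Real.log_natCast_nonneg T
  -- Here `2ε < gapMin` bounds every player's gap by `2 * gapMin`, leaving only the collective
  -- count.
  calc _ ≤ ∑ p, 2 * I.gapMin i * ∫ h, (pulls h p i : ℝ) ∂(historyLaw I A T) := by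
        refine Finset.sum_le_sum fun p _ => mul_le_mul_of_nonneg_right ?_
          (integral_nonneg fun h => Nat.cast_nonneg _)
        linarith [gap_le_gapMin_add I hI p i]
    _ = 2 * I.gapMin i * ∫ h, (groupPulls h Finset.univ i : ℝ) ∂(historyLaw I A T) := by
        rw [← Finset.mul_sum, ← integral_finsetSum _ fun p _ => integrable_pulls I A T p i]
        simp [groupPulls]
    _ ≤ 2 * I.gapMin i * (29952 * Real.log T / I.gapMin i ^ 2 + 2 * M) := by gcongr
    _ = 59904 * (Real.log T / I.gapMin i) + 4 * (M * I.gapMin i) := by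
        field_simp
        ring
    _ ≤ _ := by
        have h1 : 0 ≤ Real.log T / I.gapMin i := by positivity
        have h2 : 0 ≤ M * I.gapMin i := by positivity
        linarith

end Gaps

end MPMAB

theorem corollary1 :
    ∃ C : ℝ, 0 < C ∧
      ∀ (M K : ℕ) (ε : ℝ) (I : MPMAB.Problem M K), 1 ≤ M → I.IsEps ε →
        (I.subpar ε).card + 1 = K →
        ∃ i_star : Fin K,
          (I.subpar ε)ᶜ = {i_star} ∧
          (∀ p : Fin M, I.mean p i_star = I.optMean p) ∧
          (∀ i : Fin K, i ≠ i_star → 0 < I.gapMin i) ∧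
          ∀ (T : ℕ) (A : MPMAB.Algorithm M K), max M K < T → MPMAB.IsRobustAgg ε T A →
            MPMAB.regret I A T ≤
              C * ((∑ i ∈ Finset.univ.erase i_star, Real.log T / I.gapMin i) +
                (M : ℝ) * ∑ i ∈ Finset.univ.erase i_star, I.gapMin i) := by
  refine ⟨60000, by norm_num, fun M K ε I hM hI hcard => ?_⟩
  have : Nonempty (Fin M) := ⟨⟨0, hM⟩⟩
  have hcompl : (I.subpar ε)ᶜ.card = 1 := by
    rw [Finset.card_compl, Fintype.card_fin]
    omega
  obtain ⟨j, hj⟩ := Finset.card_eq_one.1 hcompl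
  have : Nonempty (Fin K) := ⟨j⟩
  have hopt := MPMAB.mean_eq_optMean_of_compl_subpar I hI hj
  have hsub : ∀ i, i ≠ j → i ∈ I.subpar ε := fun i hij => by
    by_contra hi
    rw [← Finset.mem_compl, hj, Finset.mem_singleton] at hi
    exact hij hi
  refine ⟨j, hj, hopt, fun i hij => ?_, fun T A hT hA => ?_⟩
  · linarith [MPMAB.lt_gapMin_of_mem_subpar I hI (hsub i hij), hI.1]
  -- Since `1 ≤ M < T`; this makes `log T` positive.
  have hT2 : 2 ≤ T := by
    have := le_max_left M K
    omega
  rw [MPMAB.regret, Finset.sum_comm, ← Finset.add_sum_erase _ _ (Finset.mem_univ j)]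
  have hzero : ∑ p, I.gap p j * ∫ h, (MPMAB.pulls h p j : ℝ) ∂(MPMAB.historyLaw I A T) = 0 :=
    Finset.sum_eq_zero fun p _ => by simp [MPMAB.Problem.gap, hopt]
  rw [hzero, zero_add, Finset.mul_sum, ← Finset.sum_add_distrib, Finset.mul_sum]
  exact Finset.sum_le_sum fun i hi =>
    MPMAB.sum_gap_mul_integral_pulls_le I hI hT hT2 hA hopt (hsub i (Finset.ne_of_mem_erase hi))
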